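/- Let $L,a,b_0,c_0>0$ and consider the coupled wave system with global Kelvin--Voigt damping and global coupling $$u_{tt}-(au_x+b_0u_{tx})_x+c_0y_t=0,\qquad y_{tt}-y_{xx}-c_0u_t=0\qquad\text{in }(0,L)\times(0,\infty),$$ with $u=y=0$ at $x=0$ and $x=L$. Let $\mathcal H=(H_0^1(0,L)\times L^2(0,L))^2$ (complex-valued functions) with the norm $$\|(u,v,y,z)\|_{\mathcal H}^2=\int_0^L\left(|v|^2+a|u_x|^2+|z|^2+|y_x|^2\right)dx,$$ and let $\mathcal A(u,v,y,z)=(v,\,(au_x+b_0v_x)_x-c_0z,\,z,\,y_{xx}+c_0v)$ with domain $$D(\mathcal A)=\{(u,v,y,z)\in\mathcal H:\ v,z\in H_0^1(0,L),\ y\in H^2(0,L),\ (au_x+b_0v_x)_x\in L^2(0,L)\},$$ normed by $\|U\|_{D(\mathcal A)}^2=\|U\|_{\mathcal H}^2+\|\mathcal AU\|_{\mathcal H}^2$. For a strong solution $U=(u,u_t,y,y_t)$ of $U'=\mathcal AU$ on $[0,\infty)$, $U(0)=U_0\in D(\mathcal A)$ (that is, $U$ is $C^1$ with values in $\mathcal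 H$ and $U(t)\in D(\mathcal A)$ for all $t\ge 0$), let $E(t)=\frac12\|U(t)\|_{\mathcal H}^2$. Then for every $\varepsilon\in(0,2)$ the energy does not decay at the rate $t^{-2/(2-\varepsilon)}$ for all initial data in $D(\mathcal A)$: there is no constant $C>0$ such that, for all $U_0\in D(\mathcal A)$ and all strong solutions $U$ with $U(0)=U_0$, $$E(t)\le \frac{C}{t^{2/(2-\varepsilon)}}\,\|U_0\|_{D(\mathcal A)}^2\qquad\text{for all }t>0.$$ -/

import Mathlib

open MeasureTheory Set Filter Topology
open scoped ContDiff ENNReal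

namespace KelvinVoigt

noncomputable section

/-! ## Sobolev spaces on the interval `(0, L)` -/

/-- The complex Hilbert space `L²(0, L)`. -/
abbrev L2 (L : ℝ) : Type := Lp ℂ 2 (volume.restrict (Ioo (0 : ℝ) L))

/-- `g` is a weak derivative of `f` on `(0, L)`: `∫ φ' f = - ∫ φ g` for every test function
`φ ∈ C_c^∞(0, L)`. -/
def HasWeakDeriv (L : ℝ) (f g : L2 L) : Prop :=
  ∀ φ : ℝ → ℝ, ContDiff ℝ ∞ φ → HasCompactSupport φ → tsupport φ ⊆ Ioo 0 L →
    ∫ x in Ioo 0 L, deriv φ x • f x = - ∫ x in Ioo 0 L, φ x • g x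

theorem integrable_smul_L2 {L : ℝ} {φ : ℝ → ℝ} (hφ : Continuous φ) (f : L2 L) :
    Integrable (fun x => φ x • f x) (volume.restrict (Ioo 0 L)) := by
  have hf : Integrable (fun x => f x) (volume.restrict (Ioo 0 L)) :=
    (Lp.memLp f).integrable (by norm_num)
  obtain ⟨C, hC⟩ := isCompact_Icc.exists_bound_of_continuousOn (s := Icc 0 L) hφ.continuousOn
  refine hf.bdd_smul C hφ.aestronglyMeasurable ?_
  filter_upwards [ae_restrict_mem measurableSet_Ioo] with x hx
  exact hC x (Ioo_subset_Icc_self hx)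

theorem continuous_deriv_of_smooth {φ : ℝ → ℝ} (hφ : ContDiff ℝ ∞ φ) : Continuous (deriv φ) :=
  hφ.continuous_deriv (by simp)

theorem integral_smul_add {L : ℝ} {φ : ℝ → ℝ} (hφ : Continuous φ) (f g : L2 L) :
    ∫ x in Ioo 0 L, φ x • (f + g) x
      = (∫ x in Ioo 0 L, φ x • f x) + ∫ x in Ioo 0 L, φ x • g x := by
  rw [← integral_add (integrable_smul_L2 hφ f) (integrable_smul_L2 hφ g)]
  refine integral_congr_ae ?_
  filter_upwards [Lp.coeFn_add f g] with x hx
  rw [hx, Pi.add_apply, smul_add]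

theorem integral_smul_smul {L : ℝ} (φ : ℝ → ℝ) (c : ℂ) (f : L2 L) :
    ∫ x in Ioo 0 L, φ x • (c • f) x = c * ∫ x in Ioo 0 L, φ x • f x := by
  rw [← integral_const_mul]
  refine integral_congr_ae ?_
  filter_upwards [Lp.coeFn_smul c f] with x hx
  simp only [hx, Pi.smul_apply, smul_eq_mul, Complex.real_smul]
  ring

theorem integral_smul_zero {L : ℝ} (φ : ℝ → ℝ) :
    ∫ x in Ioo 0 L, φ x • (0 : L2 L) x = 0 := by
  refine integral_eq_zero_of_ae ?_
  filter_upwards [Lp.coeFn_zero ℂ 2 (volume.restrict (Ioo 0 L))] with x hx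
  rw [hx]
  exact smul_zero _

namespace HasWeakDeriv

theorem add {L : ℝ} {f g f' g' : L2 L} (hf : HasWeakDeriv L f f') (hg : HasWeakDeriv L g g') :
    HasWeakDeriv L (f + g) (f' + g') := by
  intro φ h1 h2 h3
  rw [integral_smul_add (continuous_deriv_of_smooth h1), integral_smul_add h1.continuous,
    hf φ h1 h2 h3, hg φ h1 h2 h3]
  ring

theorem smul {L : ℝ} {f f' : L2 L} (c : ℂ) (hf : HasWeakDeriv L f f') :
    HasWeakDeriv L (c • f) (c • f') := by
  intro φ h1 h2 h3
  rw [integral_smul_smul, integral_smul_smul, hf φ h1 h2 h3]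
  ring

theorem zero {L : ℝ} : HasWeakDeriv L 0 0 := by
  intro φ h1 h2 h3
  rw [integral_smul_zero, integral_smul_zero, neg_zero]

end HasWeakDeriv

/-- The fundamental lemma of the calculus of variations in `L²(0, L)`. -/
theorem eq_zero_of_integral_smul {L : ℝ} (h : L2 L)
    (H : ∀ φ : ℝ → ℝ, ContDiff ℝ ∞ φ → HasCompactSupport φ → tsupport φ ⊆ Ioo 0 L →
      ∫ x in Ioo 0 L, φ x • h x = 0) : h = 0 := by
  have hloc : LocallyIntegrableOn (fun x => h x) (Ioo 0 L) (volume : Measure ℝ) := by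
    have : IntegrableOn (fun x => h x) (Ioo 0 L) (volume : Measure ℝ) :=
      (Lp.memLp h).integrable (by norm_num)
    exact this.locallyIntegrableOn
  have key := isOpen_Ioo.ae_eq_zero_of_integral_contDiff_smul_eq_zero (U := Ioo 0 L) hloc (by
    intro φ h1 h2 h3
    rw [← H φ h1 h2 h3]
    symm
    refine setIntegral_eq_integral_of_forall_compl_eq_zero ?_
    intro x hx
    have : φ x = 0 := by
      by_contra hne
      exact hx (h3 (subset_tsupport _ hne))
    simp [this])
  rw [Lp.eq_zero_iff_ae_eq_zero]
  exact (ae_restrict_iff' measurableSet_Ioo).2 key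

theorem HasWeakDeriv.unique {L : ℝ} {f g g' : L2 L} (h : HasWeakDeriv L f g)
    (h' : HasWeakDeriv L f g') : g = g' := by
  have h0 : HasWeakDeriv L 0 (g + (-1 : ℂ) • g') := by
    have := h.add (h'.smul (-1))
    simpa using this
  have : g + (-1 : ℂ) • g' = 0 := by
    refine eq_zero_of_integral_smul _ ?_
    intro φ h1 h2 h3
    have := h0 φ h1 h2 h3
    rw [integral_smul_zero] at this
    simpa using this.symm
  rw [neg_smul, one_smul, ← sub_eq_add_neg] at this
  exact sub_eq_zero.1 this

/-- The Sobolev space `H¹(0, L)`. -/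
def H1 (L : ℝ) : Submodule ℂ (L2 L) where
  carrier := {f | ∃ g, HasWeakDeriv L f g}
  add_mem' := by
    rintro f g ⟨f', hf⟩ ⟨g', hg⟩
    exact ⟨_, hf.add hg⟩
  zero_mem' := ⟨0, HasWeakDeriv.zero⟩
  smul_mem' := by
    rintro c f ⟨f', hf⟩
    exact ⟨_, hf.smul c⟩

open Classical in
/-- The weak derivative of an element of `H¹(0, L)` (and `0` outside `H¹(0, L)`). -/
def weakDeriv {L : ℝ} (f : L2 L) : L2 L :=
  if h : ∃ g, HasWeakDeriv L f g then h.choose else 0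

theorem hasWeakDeriv_weakDeriv {L : ℝ} {f : L2 L} (hf : f ∈ H1 L) :
    HasWeakDeriv L f (weakDeriv f) := by
  have h : ∃ g, HasWeakDeriv L f g := hf
  rw [weakDeriv, dif_pos h]
  exact h.choose_spec

theorem HasWeakDeriv.weakDeriv_eq {L : ℝ} {f g : L2 L} (h : HasWeakDeriv L f g) :
    weakDeriv f = g :=
  (hasWeakDeriv_weakDeriv ⟨g, h⟩).unique h

theorem weakDeriv_add {L : ℝ} {f g : L2 L} (hf : f ∈ H1 L) (hg : g ∈ H1 L) :
    weakDeriv (f + g) = weakDeriv f + weakDeriv g :=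
  ((hasWeakDeriv_weakDeriv hf).add (hasWeakDeriv_weakDeriv hg)).weakDeriv_eq

theorem weakDeriv_smul {L : ℝ} (c : ℂ) {f : L2 L} (hf : f ∈ H1 L) :
    weakDeriv (c • f) = c • weakDeriv f :=
  ((hasWeakDeriv_weakDeriv hf).smul c).weakDeriv_eq

/-- `u` has a continuous representative on `[0, L]` that vanishes at both end points. -/
def VanishesAtEnds (L : ℝ) (u : L2 L) : Prop :=
  ∃ f : ℝ → ℂ, ContinuousOn f (Icc 0 L) ∧ f 0 = 0 ∧ f L = 0 ∧
    (fun x => u x) =ᵐ[volume.restrict (Ioo 0 L)] f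

/-- The Sobolev space `H¹₀(0, L) = {u ∈ H¹(0, L) : u(0) = u(L) = 0}`. -/
def H10 (L : ℝ) : Submodule ℂ (L2 L) where
  carrier := {u | u ∈ H1 L ∧ VanishesAtEnds L u}
  add_mem' := by
    rintro u w ⟨hu, f, hf, hf0, hfL, huf⟩ ⟨hw, g, hg, hg0, hgL, hwg⟩
    refine ⟨(H1 L).add_mem hu hw, fun x => f x + g x, hf.add hg, by simp [hf0, hg0],
      by simp [hfL, hgL], ?_⟩
    filter_upwards [Lp.coeFn_add u w, huf, hwg] with x h1 h2 h3
    rw [h1, Pi.add_apply, h2, h3]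
  zero_mem' := by
    refine ⟨(H1 L).zero_mem, fun _ => 0, continuousOn_const, rfl, rfl, ?_⟩
    filter_upwards [Lp.coeFn_zero ℂ 2 (volume.restrict (Ioo 0 L))] with x hx
    rw [hx, Pi.zero_apply]
  smul_mem' := by
    rintro c u ⟨hu, f, hf, hf0, hfL, huf⟩
    refine ⟨(H1 L).smul_mem c hu, fun x => c * f x, continuousOn_const.mul hf, by simp [hf0],
      by simp [hfL], ?_⟩
    filter_upwards [Lp.coeFn_smul c u, huf] with x h1 h2
    rw [h1, Pi.smul_apply, h2, smul_eq_mul]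

theorem H10_le_H1 (L : ℝ) : H10 L ≤ H1 L := fun _ h => h.1

/-- A function with zero mean supported in the open interval is the derivative of a test
function. -/
theorem exists_primitive {L : ℝ} (hL : 0 < L) {ψ : ℝ → ℝ} (h1 : ContDiff ℝ ∞ ψ)
    (h2 : HasCompactSupport ψ) (h3 : tsupport ψ ⊆ Ioo 0 L) (h0 : ∫ x in Ioo 0 L, ψ x = 0) :
    ∃ φ : ℝ → ℝ, ContDiff ℝ ∞ φ ∧ HasCompactSupport φ ∧ tsupport φ ⊆ Ioo 0 L ∧
      deriv φ = ψ := by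
  obtain ⟨α, β, hα, hβ, hsub⟩ : ∃ α β : ℝ, 0 < α ∧ β < L ∧ tsupport ψ ⊆ Icc α β := by
    rcases (tsupport ψ).eq_empty_or_nonempty with he | hne
    · exact ⟨L / 2, L / 2, by linarith, by linarith, by simp [he]⟩
    · obtain ⟨α, hα, hα'⟩ := h2.isCompact.exists_isLeast hne
      obtain ⟨β, hβ, hβ'⟩ := h2.isCompact.exists_isGreatest hne
      exact ⟨α, β, (h3 hα).1, (h3 hβ).2, fun x hx => ⟨hα' hx, hβ' hx⟩⟩
  have hz : ∀ x, x ∉ Icc α β → ψ x = 0 := fun x hx => by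
    by_contra hne
    exact hx (hsub (subset_tsupport _ hne))
  have hder : ∀ x, HasDerivAt (fun x => ∫ t in (0 : ℝ)..x, ψ t) (ψ x) x := fun x =>
    intervalIntegral.integral_hasDerivAt_right (h1.continuous.intervalIntegrable _ _)
      h1.continuous.stronglyMeasurable.stronglyMeasurableAtFilter h1.continuous.continuousAt
  have hd : deriv (fun x => ∫ t in (0 : ℝ)..x, ψ t) = ψ := funext fun x => (hder x).deriv
  have htot : ∫ t in (0 : ℝ)..L, ψ t = 0 := by
    rw [intervalIntegral.integral_of_le hL.le, integral_Ioc_eq_integral_Ioo, h0]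
  have hvan : ∀ x, x ∉ Icc α β → ∫ t in (0 : ℝ)..x, ψ t = 0 := by
    intro x hx
    rw [mem_Icc, not_and_or, not_le, not_le] at hx
    rcases hx with hx | hx
    · refine intervalIntegral.integral_zero_ae ?_
      refine ae_of_all _ fun t ht => hz t fun ht' => ?_
      rcases uIoc_subset_uIcc ht with ⟨-, h5⟩
      have : max 0 x < α := max_lt hα hx
      exact absurd ht'.1 (not_le.2 (lt_of_le_of_lt h5 this))
    · have hadd := intervalIntegral.integral_add_adjacent_intervals
        (h1.continuous.intervalIntegrable (μ := volume) 0 L)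
        (h1.continuous.intervalIntegrable (μ := volume) L x)
      rw [← hadd, htot, zero_add]
      refine intervalIntegral.integral_zero_ae ?_
      refine ae_of_all _ fun t ht => hz t fun ht' => ?_
      rcases uIoc_subset_uIcc ht with ⟨h5, -⟩
      have : β < min L x := lt_min hβ hx
      exact absurd ht'.2 (not_le.2 (lt_of_lt_of_le this h5))
  have hts : tsupport (fun x => ∫ t in (0 : ℝ)..x, ψ t) ⊆ Icc α β := by
    refine closure_minimal ?_ isClosed_Icc
    intro x hx
    by_contra hne
    exact hx (hvan x hne)
  refine ⟨fun x => ∫ t in (0 : ℝ)..x, ψ t, ?_, ?_, ?_, hd⟩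
  · rw [contDiff_infty_iff_deriv, hd]
    exact ⟨fun x => (hder x).differentiableAt, h1⟩
  · exact HasCompactSupport.intro isCompact_Icc hvan
  · exact hts.trans fun x hx => ⟨hα.trans_le hx.1, hx.2.trans_lt hβ⟩

/-- An element of `H¹₀(0, L)` whose weak derivative vanishes is zero. -/
theorem eq_zero_of_weakDeriv_eq_zero {L : ℝ} (hL : 0 < L) {u : L2 L} (hu : u ∈ H10 L)
    (h0 : weakDeriv u = 0) : u = 0 := by
  obtain ⟨hu1, f, hf, hf0, -, huf⟩ := hu
  have hw : HasWeakDeriv L u 0 := h0 ▸ hasWeakDeriv_weakDeriv hu1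
  obtain ⟨η, hη1, hη2, hη3, hηI⟩ : ∃ η : ℝ → ℝ, ContDiff ℝ ∞ η ∧ HasCompactSupport η ∧
      tsupport η ⊆ Ioo 0 L ∧ ∫ x in Ioo 0 L, η x = 1 := by
    let b : ContDiffBump (L / 2 : ℝ) := ⟨L / 8, L / 4, by positivity, by linarith⟩
    have hsup : tsupport (b.normed volume) ⊆ Ioo 0 L := by
      rw [b.tsupport_normed_eq, Real.closedBall_eq_Icc]
      intro x hx
      have h1 : L / 2 - L / 4 ≤ x := hx.1
      have h2 : x ≤ L / 2 + L / 4 := hx.2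
      exact ⟨by linarith, by linarith⟩
    refine ⟨b.normed volume, b.contDiff_normed, b.hasCompactSupport_normed, hsup, ?_⟩
    rw [← b.integral_normed (μ := volume)]
    refine setIntegral_eq_integral_of_forall_compl_eq_zero fun x hx => ?_
    by_contra hne
    exact hx (hsup (subset_tsupport _ hne))
  set k : ℂ := ∫ x in Ioo 0 L, η x • u x with hk
  have hconst : MemLp (fun _ : ℝ => k) 2 (volume.restrict (Ioo 0 L)) := memLp_const k
  have hkey : u + (-1 : ℂ) • hconst.toLp = 0 := by
    refine eq_zero_of_integral_smul _ fun ψ h1 h2 h3 => ?_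
    rw [integral_smul_add h1.continuous, integral_smul_smul]
    set m : ℝ := ∫ x in Ioo 0 L, ψ x with hm
    have hi : ∀ θ : ℝ → ℝ, Continuous θ → IntegrableOn θ (Ioo 0 L) := fun θ hθ =>
      (hθ.integrableOn_Icc (a := 0) (b := L)).mono_set Ioo_subset_Icc_self
    have hmη : ContDiff ℝ ∞ (fun x => ψ x - m * η x) := h1.sub (contDiff_const.mul hη1)
    have hs : tsupport (fun x => ψ x - m * η x) ⊆ tsupport ψ ∪ tsupport η := by
      refine closure_minimal ?_ ((isClosed_tsupport _).union (isClosed_tsupport _))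
      intro x hx
      by_contra hne
      rw [mem_union, not_or] at hne
      apply hx
      simp [image_eq_zero_of_notMem_tsupport hne.1, image_eq_zero_of_notMem_tsupport hne.2]
    obtain ⟨φ, p1, p2, p3, p4⟩ := exists_primitive hL hmη
      ((h2.isCompact.union hη2.isCompact).of_isClosed_subset (isClosed_tsupport _) hs)
      (hs.trans (union_subset h3 hη3)) (by
        rw [integral_sub (hi _ h1.continuous) ((hi _ hη1.continuous).const_mul m),
          integral_const_mul, hηI, ← hm]
        ring)
    have e1 := hw φ p1 p2 p3
    rw [integral_smul_zero, neg_zero, p4] at e1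
    have e2 : ∫ x in Ioo 0 L, (ψ x - m * η x) • u x
        = (∫ x in Ioo 0 L, ψ x • u x) - m * k := by
      rw [hk, ← integral_const_mul, ← integral_sub (integrable_smul_L2 h1.continuous u)
        ((integrable_smul_L2 hη1.continuous u).const_mul _)]
      congr 1
      ext x
      simp only [Complex.real_smul]
      push_cast
      ring
    have e3 : ∫ x in Ioo 0 L, ψ x • (hconst.toLp : L2 L) x = m * k := by
      have hmC : (m : ℂ) = ∫ x in Ioo 0 L, (ψ x : ℂ) := integral_ofReal.symm
      rw [hmC, ← integral_mul_const]
      refine integral_congr_ae ?_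
      filter_upwards [hconst.coeFn_toLp] with x hx
      rw [hx, Complex.real_smul]
    rw [e3, ← e1, e2]
    ring
  have huk : u = hconst.toLp := by
    rw [neg_smul, one_smul, ← sub_eq_add_neg] at hkey
    exact sub_eq_zero.1 hkey
  have hfk : f =ᵐ[volume.restrict (Ioo 0 L)] fun _ => k := by
    have h5 : (fun x => u x) =ᵐ[volume.restrict (Ioo 0 L)] fun _ => k := by
      rw [huk]
      exact hconst.coeFn_toLp
    exact huf.symm.trans h5
  have hEq : EqOn f (fun _ => k) (Ioo 0 L) := by
    refine Measure.eqOn_open_of_ae_eq (μ := volume) hfk isOpen_Ioo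
      (hf.mono Ioo_subset_Icc_self) continuousOn_const
  have hEq' : EqOn f (fun _ => k) (Icc 0 L) := by
    refine hEq.of_subset_closure hf continuousOn_const Ioo_subset_Icc_self ?_
    rw [closure_Ioo hL.ne]
  have hk0 : k = 0 := by
    rw [← hf0]
    exact (hEq' ⟨le_refl _, hL.le⟩).symm
  rw [huk, Lp.eq_zero_iff_ae_eq_zero]
  filter_upwards [hconst.coeFn_toLp] with x hx
  rw [hx, hk0, Pi.zero_apply]

/-! ## The energy space -/

/-- The energy space `𝓗 = (H¹₀(0, L) × L²(0, L))²` of states `U = (u, v, y, z)`; the speed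
parameter `a` enters through its inner product only. -/
@[ext]
structure EnergySpace (L a : ℝ) : Type where
  u : H10 L
  v : L2 L
  y : H10 L
  z : L2 L

namespace EnergySpace

variable {L a : ℝ}

/-- States are quadruples. -/
def equivProd (L a : ℝ) : EnergySpace L a ≃ H10 L × L2 L × H10 L × L2 L where
  toFun U := (U.u, U.v, U.y, U.z)
  invFun p := ⟨p.1, p.2.1, p.2.2.1, p.2.2.2⟩
  left_inv _ := rfl
  right_inv _ := rfl

instance instAddCommGroup : AddCommGroup (EnergySpace L a) := (equivProd L a).addCommGroup

instance instModule : Module ℂ (EnergySpace L a) := (equivProd L a).module ℂ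

@[simp] theorem add_u (U V : EnergySpace L a) : (U + V).u = U.u + V.u := rfl
@[simp] theorem add_v (U V : EnergySpace L a) : (U + V).v = U.v + V.v := rfl
@[simp] theorem add_y (U V : EnergySpace L a) : (U + V).y = U.y + V.y := rfl
@[simp] theorem add_z (U V : EnergySpace L a) : (U + V).z = U.z + V.z := rfl
@[simp] theorem smul_u (c : ℂ) (U : EnergySpace L a) : (c • U).u = c • U.u := rfl
@[simp] theorem smul_v (c : ℂ) (U : EnergySpace L a) : (c • U).v = c • U.v := rfl
@[simp] theorem smul_y (c : ℂ) (U : EnergySpace L a) : (c • U).y = c • U.y := rfl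
@[simp] theorem smul_z (c : ℂ) (U : EnergySpace L a) : (c • U).z = c • U.z := rfl
@[simp] theorem zero_u : (0 : EnergySpace L a).u = 0 := rfl
@[simp] theorem zero_v : (0 : EnergySpace L a).v = 0 := rfl
@[simp] theorem zero_y : (0 : EnergySpace L a).y = 0 := rfl
@[simp] theorem zero_z : (0 : EnergySpace L a).z = 0 := rfl

/-- The weak derivative `u_x ∈ L²(0, L)` of `u ∈ H¹₀(0, L)`, as a linear map. -/
def dx (L : ℝ) : H10 L →ₗ[ℂ] L2 L where
  toFun u := weakDeriv (u : L2 L)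
  map_add' u w := weakDeriv_add (H10_le_H1 L u.2) (H10_le_H1 L w.2)
  map_smul' c u := weakDeriv_smul c (H10_le_H1 L u.2)

/-- The inner product of the energy space,
`⟨U, U₁⟩ = ∫ v v₁ + a ∫ uₓ (u₁)ₓ + ∫ z z₁ + ∫ yₓ (y₁)ₓ`, where one factor of each product is
conjugated (in Mathlib, the one that comes from the first argument of the inner product). -/
instance instCore [hL : Fact (0 < L)] [ha : Fact (0 < a)] :
    InnerProductSpace.Core ℂ (EnergySpace L a) where
  inner U W := inner ℂ U.v W.v + (a : ℂ) * inner ℂ (dx L U.u) (dx L W.u)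
    + inner ℂ U.z W.z + inner ℂ (dx L U.y) (dx L W.y)
  conj_inner_symm U W := by
    simp only [map_add, map_mul, inner_conj_symm, Complex.conj_ofReal]
  re_inner_nonneg U := by
    have ha' := ha.out
    simp only [inner_self_eq_norm_sq_to_K]
    have : (0 : ℝ) ≤ ‖U.v‖ ^ 2 + a * ‖dx L U.u‖ ^ 2 + ‖U.z‖ ^ 2 + ‖dx L U.y‖ ^ 2 := by positivity
    refine this.trans_eq ?_
    rw [← Complex.ofReal_re (‖U.v‖ ^ 2 + a * ‖dx L U.u‖ ^ 2 + ‖U.z‖ ^ 2 + ‖dx L U.y‖ ^ 2)]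
    push_cast
    rfl
  add_left U V W := by
    simp only [add_u, add_v, add_y, add_z, map_add, inner_add_left]
    ring
  smul_left U W c := by
    simp only [smul_u, smul_v, smul_y, smul_z, map_smul, inner_smul_left]
    ring
  definite U h := by
    have ha' := ha.out
    have h' : ‖U.v‖ ^ 2 + a * ‖dx L U.u‖ ^ 2 + ‖U.z‖ ^ 2 + ‖dx L U.y‖ ^ 2 = 0 := by
      have h2 := h
      simp only [inner_self_eq_norm_sq_to_K] at h2
      apply Complex.ofReal_injective
      push_cast
      exact h2
    have p1 : 0 ≤ ‖U.v‖ ^ 2 := by positivity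
    have p2 : 0 ≤ a * ‖dx L U.u‖ ^ 2 := by positivity
    have p3 : 0 ≤ ‖U.z‖ ^ 2 := by positivity
    have p4 : 0 ≤ ‖dx L U.y‖ ^ 2 := by positivity
    have q1 : ‖U.v‖ ^ 2 = 0 := by linarith
    have q2 : a * ‖dx L U.u‖ ^ 2 = 0 := by linarith
    have q3 : ‖U.z‖ ^ 2 = 0 := by linarith
    have q4 : ‖dx L U.y‖ ^ 2 = 0 := by linarith
    have q2' : ‖dx L U.u‖ ^ 2 = 0 := (mul_eq_zero.1 q2).resolve_left ha'.ne'
    have r2 : weakDeriv (U.u : L2 L) = 0 := norm_eq_zero.1 (pow_eq_zero_iff two_ne_zero |>.1 q2')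
    have r4 : weakDeriv (U.y : L2 L) = 0 := norm_eq_zero.1 (pow_eq_zero_iff two_ne_zero |>.1 q4)
    apply EnergySpace.ext
    · exact Subtype.ext (eq_zero_of_weakDeriv_eq_zero hL.out U.u.2 r2)
    · exact norm_eq_zero.1 (pow_eq_zero_iff two_ne_zero |>.1 q1)
    · exact Subtype.ext (eq_zero_of_weakDeriv_eq_zero hL.out U.y.2 r4)
    · exact norm_eq_zero.1 (pow_eq_zero_iff two_ne_zero |>.1 q3)

instance instNormedAddCommGroup [Fact (0 < L)] [Fact (0 < a)] :
    NormedAddCommGroup (EnergySpace L a) :=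
  InnerProductSpace.Core.toNormedAddCommGroup (𝕜 := ℂ)

instance instInnerProductSpace [Fact (0 < L)] [Fact (0 < a)] :
    InnerProductSpace ℂ (EnergySpace L a) :=
  InnerProductSpace.ofCore instCore.toCore

end EnergySpace

/-! ## The operator with global damping and coupling, and its strong solutions -/

/-- The domain of the operator with constant damping `b₀`: all `(u, v, y, z) ∈ 𝓗` such that
`v, z ∈ H¹₀(0, L)`, `y ∈ H²(0, L)` and `(a uₓ + b₀ vₓ)ₓ ∈ L²(0, L)`. -/
def waveDomain (L a b₀ : ℝ) : Submodule ℂ (EnergySpace L a) where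
  carrier := {U | U.v ∈ H10 L ∧ U.z ∈ H10 L ∧ weakDeriv (U.y : L2 L) ∈ H1 L ∧
    (a : ℂ) • weakDeriv (U.u : L2 L) + (b₀ : ℂ) • weakDeriv U.v ∈ H1 L}
  add_mem' := by
    rintro U W ⟨h1, h2, h3, h4⟩ ⟨k1, k2, k3, k4⟩
    refine ⟨(H10 L).add_mem h1 k1, (H10 L).add_mem h2 k2, ?_, ?_⟩
    · have := (H1 L).add_mem h3 k3
      rwa [← weakDeriv_add (H10_le_H1 L U.y.2) (H10_le_H1 L W.y.2)] at this
    · have := (H1 L).add_mem h4 k4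
      rw [add_add_add_comm, ← smul_add, ← smul_add,
        ← weakDeriv_add (H10_le_H1 L U.u.2) (H10_le_H1 L W.u.2),
        ← weakDeriv_add (H10_le_H1 L h1) (H10_le_H1 L k1)] at this
      exact this
  zero_mem' := by
    have h0 : weakDeriv (0 : L2 L) = 0 := HasWeakDeriv.zero.weakDeriv_eq
    refine ⟨(H10 L).zero_mem, (H10 L).zero_mem, ?_, ?_⟩
    · simp [h0]
    · simp [h0]
  smul_mem' := by
    rintro r U ⟨h1, h2, h3, h4⟩
    refine ⟨(H10 L).smul_mem r h1, (H10 L).smul_mem r h2, ?_, ?_⟩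
    · have := (H1 L).smul_mem r h3
      rwa [← weakDeriv_smul r (H10_le_H1 L U.y.2)] at this
    · have := (H1 L).smul_mem r h4
      rw [smul_add, smul_comm r, smul_comm r, ← weakDeriv_smul r (H10_le_H1 L U.u.2),
        ← weakDeriv_smul r (H10_le_H1 L h1)] at this
      exact this

/-- The second component `(a uₓ + b₀ vₓ)ₓ - c₀ z` of `𝓐 (u, v, y, z)`. -/
def waveForceU {L a : ℝ} (b₀ c₀ : ℝ) (U : EnergySpace L a) : L2 L :=
  weakDeriv ((a : ℂ) • weakDeriv (U.u : L2 L) + (b₀ : ℂ) • weakDeriv U.v) - (c₀ : ℂ) • U.z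

/-- The fourth component `yₓₓ + c₀ v` of `𝓐 (u, v, y, z)`. -/
def waveForceY {L a : ℝ} (c₀ : ℝ) (U : EnergySpace L a) : L2 L :=
  weakDeriv (weakDeriv (U.y : L2 L)) + (c₀ : ℂ) • U.v

theorem waveForceU_add {L a b₀ : ℝ} (c₀ : ℝ) {U W : EnergySpace L a}
    (hU : U ∈ waveDomain L a b₀) (hW : W ∈ waveDomain L a b₀) :
    waveForceU b₀ c₀ (U + W) = waveForceU b₀ c₀ U + waveForceU b₀ c₀ W := by
  obtain ⟨h1, -, -, h4⟩ := hU
  obtain ⟨k1, -, -, k4⟩ := hW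
  simp only [waveForceU, EnergySpace.add_u, EnergySpace.add_v, EnergySpace.add_z,
    Submodule.coe_add]
  rw [weakDeriv_add (H10_le_H1 L U.u.2) (H10_le_H1 L W.u.2),
    weakDeriv_add (H10_le_H1 L h1) (H10_le_H1 L k1), smul_add, smul_add,
    add_add_add_comm, weakDeriv_add h4 k4, smul_add]
  exact add_sub_add_comm _ _ _ _

theorem waveForceU_smul {L a b₀ : ℝ} (c₀ : ℝ) (r : ℂ) {U : EnergySpace L a}
    (hU : U ∈ waveDomain L a b₀) :
    waveForceU b₀ c₀ (r • U) = r • waveForceU b₀ c₀ U := by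
  obtain ⟨h1, -, -, h4⟩ := hU
  simp only [waveForceU, EnergySpace.smul_u, EnergySpace.smul_v, EnergySpace.smul_z,
    Submodule.coe_smul]
  rw [weakDeriv_smul r (H10_le_H1 L U.u.2), weakDeriv_smul r (H10_le_H1 L h1),
    smul_comm (a : ℂ) r, smul_comm (b₀ : ℂ) r, ← smul_add, weakDeriv_smul r h4,
    smul_comm (c₀ : ℂ) r, ← smul_sub]

theorem waveForceY_add {L a b₀ : ℝ} (c₀ : ℝ) {U W : EnergySpace L a}
    (hU : U ∈ waveDomain L a b₀) (hW : W ∈ waveDomain L a b₀) :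
    waveForceY c₀ (U + W) = waveForceY c₀ U + waveForceY c₀ W := by
  obtain ⟨-, -, h3, -⟩ := hU
  obtain ⟨-, -, k3, -⟩ := hW
  simp only [waveForceY, EnergySpace.add_y, EnergySpace.add_v, Submodule.coe_add]
  rw [weakDeriv_add (H10_le_H1 L U.y.2) (H10_le_H1 L W.y.2), weakDeriv_add h3 k3, smul_add]
  exact add_add_add_comm _ _ _ _

theorem waveForceY_smul {L a b₀ : ℝ} (c₀ : ℝ) (r : ℂ) {U : EnergySpace L a}
    (hU : U ∈ waveDomain L a b₀) :
    waveForceY c₀ (r • U) = r • waveForceY c₀ U := by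
  obtain ⟨-, -, h3, -⟩ := hU
  simp only [waveForceY, EnergySpace.smul_y, EnergySpace.smul_v, Submodule.coe_smul]
  rw [weakDeriv_smul r (H10_le_H1 L U.y.2), weakDeriv_smul r h3, smul_comm (c₀ : ℂ) r, ← smul_add]

/-- The operator `𝓐 (u, v, y, z) = (v, (a uₓ + b₀ vₓ)ₓ - c₀ z, z, yₓₓ + c₀ v)` in `𝓗`. -/
def waveOperator (L a b₀ c₀ : ℝ) : EnergySpace L a →ₗ.[ℂ] EnergySpace L a where
  domain := waveDomain L a b₀
  toFun :=
    { toFun := fun U =>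
        { u := ⟨U.1.v, U.2.1⟩
          v := waveForceU b₀ c₀ U.1
          y := ⟨U.1.z, U.2.2.1⟩
          z := waveForceY c₀ U.1 }
      map_add' := fun U W => EnergySpace.ext rfl (waveForceU_add c₀ U.2 W.2) rfl
        (waveForceY_add c₀ U.2 W.2)
      map_smul' := fun r U => EnergySpace.ext rfl (waveForceU_smul c₀ r U.2) rfl
        (waveForceY_smul c₀ r U.2) }

/-- `U` is a strong solution of `U' = A U`, `U(0) = U₀` on `[0, ∞)`: it is of class `C¹` with values
in `H`, and `U(t) ∈ D(A)`, `U'(t) = A U(t)` for all `t ≥ 0` (so that `U` is also continuous with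
values in `D(A)` with the graph norm). -/
structure IsStrongSolution {H : Type*} [NormedAddCommGroup H] [InnerProductSpace ℂ H]
    (A : H →ₗ.[ℂ] H) (U₀ : H) (U : ℝ → H) : Prop where
  initial : U 0 = U₀
  mem_domain : ∀ t : ℝ, 0 ≤ t → U t ∈ A.domain
  hasDerivWithinAt : ∀ (t : ℝ) (ht : 0 ≤ t),
    HasDerivWithinAt U (A ⟨U t, mem_domain t ht⟩) (Ici 0) t
  continuousOn_deriv : ContinuousOn (derivWithin U (Ici 0)) (Ici 0)

/-- The energy `E = 1/2 ∫₀ᴸ (|u_t|² + a |uₓ|² + |y_t|² + |yₓ|²)` of the state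
`(u, u_t, y, y_t)`. -/
def energy {L a : ℝ} (U : EnergySpace L a) : ℝ :=
  1 / 2 * ∫ x in Ioo 0 L, (‖U.v x‖ ^ 2 + a * ‖weakDeriv (U.u : L2 L) x‖ ^ 2
    + ‖U.z x‖ ^ 2 + ‖weakDeriv (U.y : L2 L) x‖ ^ 2)

/-- The square `‖U₀‖² + ‖A U₀‖²` of the graph norm of `D(A)`. -/
def domainNormSq {H : Type*} [NormedAddCommGroup H] [InnerProductSpace ℂ H]
    (A : H →ₗ.[ℂ] H) (U₀ : A.domain) : ℝ :=
  ‖(U₀ : H)‖ ^ 2 + ‖A U₀‖ ^ 2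

/-- The energy decays at the rate `t^{-r}` for all initial data in `D(𝓐)`: there is a constant `C`,
independent of `U₀` and `t`, with `E(t) ≤ C t^{-r} ‖U₀‖²_{D(𝓐)}` for all `U₀ ∈ D(𝓐)`, `t > 0`. -/
def EnergyDecaysAtRate (L a b₀ c₀ : ℝ) [Fact (0 < L)] [Fact (0 < a)] (r : ℝ) : Prop :=
  ∃ C : ℝ, 0 < C ∧ ∀ (U₀ : (waveOperator L a b₀ c₀).domain) (U : ℝ → EnergySpace L a),
    IsStrongSolution (waveOperator L a b₀ c₀) U₀ U →
      ∀ t : ℝ, 0 < t →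
        energy (U t) ≤ C / t ^ r * domainNormSq (waveOperator L a b₀ c₀) U₀

end

end KelvinVoigt

namespace KelvinVoigt

noncomputable section

/-! ## The energy as a norm -/

/-! The damped system still carries modes that are almost undamped. With Dirichlet ends and constant
coefficients, sin(mx) for m = nπ/L diagonalises everything: the ansatz e^{lt} sin(mx) (p, q) turns
the system into two linear equations for p and q, solvable nontrivially when P(l) = (l² + b₀m²l +
am²)(l² + m²) + c₀²l² = 0. At the frequency im of the undamped y-wave the second factor vanishes, so
P(im) = -c₀²m² is small compared with P'(im), whose real part is -2b₀m⁴. Strong damping of u at high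
frequency thus moves the y-eigenvalue only slightly: there is a root l with |l - im| ≤ K/m², K =
3c₀²/b₀ (`exists_eigenvalue`).

Such a mode loses at most the fixed factor e^{-2K} of its energy up to time m², because Re l ≥
-K/m². Its squared graph norm is (1 + |l|²)‖U₀‖² = O(m²)‖U₀‖². Decay at rate t^{-r}, tested at t =
m², would therefore bound a positive constant by a multiple of m^{2-2r}
(`EnergyDecaysAtRate.bound`). For r > 1 this tends to 0 as n → ∞, a contradiction; and 2/(2-ε) > 1.
-/

theorem integrable_norm_sq {L : ℝ} (f : L2 L) :
    Integrable (fun x => ‖f x‖ ^ 2) (volume.restrict (Ioo 0 L)) := by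
  simpa using (Lp.memLp f).integrable_norm_pow (by norm_num)

theorem integral_norm_sq {L : ℝ} (f : L2 L) : ∫ x in Ioo 0 L, ‖f x‖ ^ 2 = ‖f‖ ^ 2 := by
  have h : ((‖f‖ ^ 2 : ℝ) : ℂ) = ((∫ x in Ioo 0 L, ‖f x‖ ^ 2 : ℝ) : ℂ) := by
    rw [← integral_complex_ofReal]
    have h1 := inner_self_eq_norm_sq_to_K (𝕜 := ℂ) f
    rw [L2.inner_def] at h1
    push_cast
    refine h1.symm.trans (integral_congr_ae (ae_of_all _ fun x => ?_))
    exact inner_self_eq_norm_sq_to_K (𝕜 := ℂ) (f x)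
  exact (Complex.ofReal_injective h).symm

theorem norm_sq_energySpace {L a : ℝ} [Fact (0 < L)] [Fact (0 < a)] (U : EnergySpace L a) :
    ‖U‖ ^ 2 = ‖U.v‖ ^ 2 + a * ‖weakDeriv (U.u : L2 L)‖ ^ 2 + ‖U.z‖ ^ 2
      + ‖weakDeriv (U.y : L2 L)‖ ^ 2 := by
  have h1 := inner_self_eq_norm_sq_to_K (𝕜 := ℂ) U
  have h2 : inner ℂ U U = inner ℂ U.v U.v
      + (a : ℂ) * inner ℂ (weakDeriv (U.u : L2 L)) (weakDeriv (U.u : L2 L))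
      + inner ℂ U.z U.z + inner ℂ (weakDeriv (U.y : L2 L)) (weakDeriv (U.y : L2 L)) := rfl
  rw [h2] at h1
  simp only [inner_self_eq_norm_sq_to_K] at h1
  apply Complex.ofReal_injective
  push_cast
  exact h1.symm

/-- Makes the energy of e^{lt}U₀ computable by homogeneity of the norm. -/
theorem energy_eq_norm_sq {L a : ℝ} [Fact (0 < L)] [Fact (0 < a)] (U : EnergySpace L a) :
    energy U = 1 / 2 * ‖U‖ ^ 2 := by
  have i1 := integrable_norm_sq U.v
  have i2 := (integrable_norm_sq (weakDeriv (U.u : L2 L))).const_mul a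
  have i3 := integrable_norm_sq U.z
  have i4 := integrable_norm_sq (weakDeriv (U.y : L2 L))
  have i12 : Integrable (fun x => ‖U.v x‖ ^ 2 + a * ‖weakDeriv (U.u : L2 L) x‖ ^ 2)
      (volume.restrict (Ioo 0 L)) := i1.add i2
  have i123 : Integrable (fun x => ‖U.v x‖ ^ 2 + a * ‖weakDeriv (U.u : L2 L) x‖ ^ 2
      + ‖U.z x‖ ^ 2) (volume.restrict (Ioo 0 L)) := i12.add i3
  rw [energy, norm_sq_energySpace, integral_add i123 i4, integral_add i12 i3,
    integral_add i1 i2, integral_const_mul]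
  simp only [integral_norm_sq]

/-! ## Exponential solutions -/

/-- An eigenvector supplies an explicit strong solution, so neither generation of a semigroup nor
uniqueness is needed to refute a decay estimate. -/
theorem isStrongSolution_exp_smul {H : Type*} [NormedAddCommGroup H] [InnerProductSpace ℂ H]
    (A : H →ₗ.[ℂ] H) (U₀ : A.domain) (l : ℂ) (hU : A U₀ = l • (U₀ : H)) :
    IsStrongSolution A U₀ fun t : ℝ => Complex.exp (l * t) • (U₀ : H) := by
  have hmem : ∀ t : ℝ, Complex.exp (l * t) • (U₀ : H) ∈ A.domain := fun t =>
    A.domain.smul_mem _ U₀.2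
  have hA : ∀ t : ℝ, A ⟨_, hmem t⟩ = (Complex.exp (l * t) * l) • (U₀ : H) := fun t => by
    have := A.map_smul (Complex.exp (l * t)) U₀
    rw [hU, smul_smul] at this
    exact this
  have hd : ∀ t : ℝ, HasDerivAt (fun t : ℝ => Complex.exp (l * t) • (U₀ : H))
      ((Complex.exp (l * t) * l) • (U₀ : H)) t := fun t => by
    have h1 : HasDerivAt (fun t : ℝ => l * (t : ℂ)) l t := by
      simpa using (Complex.ofRealCLM.hasDerivAt (x := t)).const_mul l
    exact h1.cexp.smul_const (U₀ : H)
  refine ⟨by simp, fun t _ => hmem t, fun t _ => ?_, ?_⟩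
  · rw [hA t]
    exact (hd t).hasDerivWithinAt
  · have hc : Continuous fun t : ℝ => (Complex.exp (l * t) * l) • (U₀ : H) := by fun_prop
    refine hc.continuousOn.congr fun t ht => ?_
    exact (hd t).hasDerivWithinAt.derivWithin (uniqueDiffOn_Ici 0 t ht)

/-! ## Sine modes -/

theorem memLp_of_continuous {f : ℝ → ℂ} (hf : Continuous f) (L : ℝ) :
    MemLp f 2 (volume.restrict (Ioo 0 L)) := by
  obtain ⟨C, hC⟩ := isCompact_Icc.exists_bound_of_continuousOn (s := Icc 0 L) hf.continuousOn
  refine MemLp.of_bound hf.aestronglyMeasurable C ?_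
  filter_upwards [ae_restrict_mem measurableSet_Ioo] with x hx
  exact hC x (Ioo_subset_Icc_self hx)

/-- The class in `L²(0, L)` of a continuous function. -/
def ofContinuous (L : ℝ) (f : ℝ → ℂ) (hf : Continuous f) : L2 L := (memLp_of_continuous hf L).toLp

theorem coeFn_ofContinuous {L : ℝ} {f : ℝ → ℂ} (hf : Continuous f) :
    ofContinuous L f hf =ᵐ[volume.restrict (Ioo 0 L)] f := (memLp_of_continuous hf L).coeFn_toLp

/-- Integration by parts on [0, L]; the boundary terms drop out because the test function vanishes
at 0 and L. -/
theorem hasWeakDeriv_ofContinuous {L : ℝ} (hL : 0 < L) {f g : ℝ → ℂ} (hf : Continuous f)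
    (hg : Continuous g) (h : ∀ x, HasDerivAt f (g x) x) :
    HasWeakDeriv L (ofContinuous L f hf) (ofContinuous L g hg) := by
  intro φ h1 h2 h3
  have e : ∀ (ψ : ℝ → ℝ) (k : ℝ → ℂ) (hk : Continuous k),
      ∫ x in Ioo 0 L, ψ x • (ofContinuous L k hk) x = ∫ x in (0 : ℝ)..L, (ψ x : ℂ) * k x := by
    intro ψ k hk
    rw [intervalIntegral.integral_of_le hL.le, integral_Ioc_eq_integral_Ioo]
    refine integral_congr_ae ?_
    filter_upwards [coeFn_ofContinuous hk] with x hx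
    rw [hx, Complex.real_smul]
  have h0 : φ 0 = 0 := image_eq_zero_of_notMem_tsupport fun hx => lt_irrefl _ (h3 hx).1
  have hL0 : φ L = 0 := image_eq_zero_of_notMem_tsupport fun hx => lt_irrefl _ (h3 hx).2
  have hφ : ∀ x, HasDerivAt (fun x => (φ x : ℂ)) ((deriv φ x : ℝ) : ℂ) x := fun x =>
    ((h1.differentiable (by simp)) x).hasDerivAt.ofReal_comp
  have hc := continuous_deriv_of_smooth h1
  rw [e, e, intervalIntegral.integral_mul_deriv_eq_deriv_mul (u := fun x => (φ x : ℂ)) (v := f)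
    (fun x _ => hφ x) (fun x _ => h x)
    ((Complex.continuous_ofReal.comp hc).intervalIntegrable _ _) (hg.intervalIntegrable _ _)]
  simp [h0, hL0]

theorem ofContinuous_smul (L : ℝ) (c : ℂ) {f : ℝ → ℂ} (hf : Continuous f) :
    ofContinuous L (fun x => c * f x) (continuous_const.mul hf) = c • ofContinuous L f hf := rfl

/-- The class of `x ↦ sin (m x)` in `L²(0, L)`. -/
def sinMode (L m : ℝ) : L2 L := ofContinuous L (fun x => (Real.sin (m * x) : ℂ)) (by fun_prop)

/-- The class of `x ↦ cos (m x)` in `L²(0, L)`. -/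
def cosMode (L m : ℝ) : L2 L := ofContinuous L (fun x => (Real.cos (m * x) : ℂ)) (by fun_prop)

theorem hasWeakDeriv_sinMode {L : ℝ} (hL : 0 < L) (m : ℝ) :
    HasWeakDeriv L (sinMode L m) ((m : ℂ) • cosMode L m) := by
  rw [cosMode, ← ofContinuous_smul]
  refine hasWeakDeriv_ofContinuous hL _ _ fun x => ?_
  have h : HasDerivAt (fun y => Real.sin (m * y)) (m * Real.cos (m * x)) x := by
    simpa [mul_comm] using ((hasDerivAt_id' x).const_mul m).sin
  exact_mod_cast h.ofReal_comp

theorem hasWeakDeriv_cosMode {L : ℝ} (hL : 0 < L) (m : ℝ) :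
    HasWeakDeriv L (cosMode L m) ((-m : ℂ) • sinMode L m) := by
  rw [sinMode, ← ofContinuous_smul]
  refine hasWeakDeriv_ofContinuous hL _ _ fun x => ?_
  have h : HasDerivAt (fun y => Real.cos (m * y)) (-m * Real.sin (m * x)) x := by
    simpa [mul_comm] using ((hasDerivAt_id' x).const_mul m).cos
  exact_mod_cast h.ofReal_comp

theorem sinMode_mem_H10 {L : ℝ} (hL : 0 < L) {m : ℝ} (hm : Real.sin (m * L) = 0) :
    sinMode L m ∈ H10 L :=
  ⟨⟨_, hasWeakDeriv_sinMode hL m⟩, fun x => (Real.sin (m * x) : ℂ),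
    Continuous.continuousOn (by fun_prop), by simp, by simp [hm], coeFn_ofContinuous _⟩

theorem sinMode_ne_zero {L : ℝ} (hL : 0 < L) {m : ℝ} (hm : 0 < m) : sinMode L m ≠ 0 := by
  intro h0
  have h1 : (fun x => (Real.sin (m * x) : ℂ)) =ᵐ[volume.restrict (Ioo 0 L)] fun _ => 0 := by
    have h2 := (Lp.eq_zero_iff_ae_eq_zero.1 h0)
    exact (coeFn_ofContinuous _).symm.trans h2
  have h3 := Measure.eqOn_open_of_ae_eq (μ := volume) h1 isOpen_Ioo
    (Continuous.continuousOn (by fun_prop)) continuousOn_const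
  -- A point of (0, L) where mx ≤ 1 < π, so that sin(mx) > 0. It contradicts vanishing everywhere,
  -- to which continuity upgrades vanishing almost everywhere.
  have hp : 0 < min (L / 2) (1 / m) := by positivity
  have h4 := h3 (x := min (L / 2) (1 / m)) ⟨hp, (min_le_left _ _).trans_lt (by linarith)⟩
  have h5 : m * min (L / 2) (1 / m) ≤ 1 := by
    calc m * min (L / 2) (1 / m) ≤ m * (1 / m) := by gcongr; exact min_le_right _ _
      _ = 1 := by field_simp
  have h6 : 0 < Real.sin (m * min (L / 2) (1 / m)) :=
    Real.sin_pos_of_pos_of_lt_pi (by positivity) (h5.trans_lt (by linarith [Real.pi_gt_three]))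
  exact h6.ne' (Complex.ofReal_eq_zero.1 h4)

/-! ## Eigenvectors -/

/-- The state `(p φ, l p φ, q φ, l q φ)` with `φ = sin (m x)`. -/
def modeState {L : ℝ} (a : ℝ) {m : ℝ} (hφ : sinMode L m ∈ H10 L) (l p q : ℂ) :
    EnergySpace L a where
  u := p • ⟨sinMode L m, hφ⟩
  v := (l * p) • sinMode L m
  y := q • ⟨sinMode L m, hφ⟩
  z := (l * q) • sinMode L m

theorem weakDeriv_smul_sinMode {L : ℝ} (hL : 0 < L) (m : ℝ) (r : ℂ) :
    weakDeriv (r • sinMode L m) = (r * m) • cosMode L m := by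
  rw [((hasWeakDeriv_sinMode hL m).smul r).weakDeriv_eq, smul_smul]

theorem weakDeriv_smul_cosMode {L : ℝ} (hL : 0 < L) (m : ℝ) (r : ℂ) :
    weakDeriv (r • cosMode L m) = (-(r * m)) • sinMode L m := by
  rw [((hasWeakDeriv_cosMode hL m).smul r).weakDeriv_eq, smul_smul, mul_neg]

theorem stress_modeState {L : ℝ} (hL : 0 < L) (a b₀ : ℝ) {m : ℝ} (hφ : sinMode L m ∈ H10 L)
    (l p q : ℂ) :
    (a : ℂ) • weakDeriv ((modeState a hφ l p q).u : L2 L)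
      + (b₀ : ℂ) • weakDeriv (modeState a hφ l p q).v = ((a + b₀ * l) * p * m) • cosMode L m := by
  simp only [modeState, Submodule.coe_smul, weakDeriv_smul_sinMode hL, smul_smul, ← add_smul]
  congr 1
  ring

theorem smul_cosMode_mem_H1 {L : ℝ} (hL : 0 < L) (m : ℝ) (r : ℂ) : r • cosMode L m ∈ H1 L :=
  (H1 L).smul_mem r ⟨_, hasWeakDeriv_cosMode hL m⟩

theorem modeState_mem_waveDomain {L : ℝ} (hL : 0 < L) (a b₀ : ℝ) {m : ℝ}
    (hφ : sinMode L m ∈ H10 L) (l p q : ℂ) : modeState a hφ l p q ∈ waveDomain L a b₀ := by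
  refine ⟨(H10 L).smul_mem _ hφ, (H10 L).smul_mem _ hφ, ?_, ?_⟩
  · simp only [modeState, Submodule.coe_smul, weakDeriv_smul_sinMode hL]
    exact smul_cosMode_mem_H1 hL m _
  · rw [stress_modeState hL]
    exact smul_cosMode_mem_H1 hL m _

/-- The hypotheses are the coefficients of sin(mx) in the two force components; the other two
components hold by the choice v = lu, z = ly. -/
theorem waveOperator_modeState {L : ℝ} (hL : 0 < L) (a b₀ c₀ : ℝ) {m : ℝ}
    (hφ : sinMode L m ∈ H10 L) {l p q : ℂ}
    (h1 : (l ^ 2 + b₀ * m ^ 2 * l + a * m ^ 2) * p + c₀ * l * q = 0)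
    (h2 : (l ^ 2 + m ^ 2) * q = c₀ * l * p) :
    waveOperator L a b₀ c₀ ⟨modeState a hφ l p q, modeState_mem_waveDomain hL a b₀ hφ l p q⟩
      = l • modeState a hφ l p q := by
  refine EnergySpace.ext ?_ ?_ ?_ ?_
  · exact Subtype.ext (mul_smul _ _ _)
  · change waveForceU b₀ c₀ (modeState a hφ l p q) = l • (modeState a hφ l p q).v
    rw [waveForceU, stress_modeState hL, weakDeriv_smul_cosMode hL]
    simp only [modeState, smul_smul, ← sub_smul]
    congr 1
    linear_combination -h1
  · exact Subtype.ext (mul_smul _ _ _)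
  · change waveForceY c₀ (modeState a hφ l p q) = l • (modeState a hφ l p q).z
    rw [waveForceY]
    simp only [modeState, Submodule.coe_smul, weakDeriv_smul_sinMode hL, weakDeriv_smul_cosMode hL,
      smul_smul, ← add_smul]
    congr 1
    linear_combination -h2

/-! ## Eigenvalues close to the imaginary axis -/

/-- A complex polynomial has a root within distance `n |P(w)| / |P'(w)|` of any point `w`. -/
theorem exists_root_near {P : Polynomial ℂ} {w : ℂ} {d : ℝ} (hP : P.eval w ≠ 0) (hd : 0 < d)
    (h : P.natDegree * ‖P.eval w‖ < d * ‖P.derivative.eval w‖) :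
    ∃ l, P.IsRoot l ∧ ‖w - l‖ ≤ d := by
  by_contra! hcon
  -- P'(w)/P(w) is the sum of 1/(w - z) over the roots z with multiplicity. If every root were
  -- farther than d from w, this sum would have norm at most deg P / d, against the hypothesis.
  have h1 := (IsAlgClosed.splits P).eval_derivative_div_eval_of_ne_zero hP
  have h2 : ‖(P.roots.map fun z ↦ 1 / (w - z)).sum‖ ≤ P.natDegree * d⁻¹ := by
    refine (norm_multiset_sum_le _).trans ?_
    rw [Multiset.map_map]
    refine (Multiset.sum_le_card_nsmul _ d⁻¹ ?_).trans ?_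
    · intro x hx
      obtain ⟨z, hz, rfl⟩ := Multiset.mem_map.1 hx
      have h3 := hcon z (Polynomial.isRoot_of_mem_roots hz)
      rw [Function.comp_apply, norm_div, norm_one, one_div]
      exact inv_anti₀ hd h3.le
    · rw [Multiset.card_map, nsmul_eq_mul]
      gcongr
      exact P.card_roots'
  rw [← h1, norm_div, div_le_iff₀ (norm_pos_iff.2 hP)] at h2
  have h3 := mul_le_mul_of_nonneg_left h2 hd.le
  have h4 : d * (P.natDegree * d⁻¹ * ‖P.eval w‖) = P.natDegree * ‖P.eval w‖ := by
    field_simp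
  linarith

open Polynomial in
/-- The characteristic equation of the mode with wave number `m` has a root at distance at most
`3 c₀² / (b₀ m²)` of `i m`. -/
theorem exists_eigenvalue (a : ℝ) {b₀ c₀ m : ℝ} (hb : 0 < b₀) (hc : 0 < c₀) (hm : 0 < m) :
    ∃ l : ℂ, (l ^ 2 + b₀ * m ^ 2 * l + a * m ^ 2) * (l ^ 2 + m ^ 2) + c₀ ^ 2 * l ^ 2 = 0 ∧
      ‖Complex.I * m - l‖ ≤ 3 * c₀ ^ 2 / (b₀ * m ^ 2) := by
  let P : ℂ[X] := (X ^ 2 + C (b₀ * m ^ 2 : ℂ) * X + C (a * m ^ 2 : ℂ)) * (X ^ 2 + C (m ^ 2 : ℂ))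
    + C (c₀ ^ 2 : ℂ) * X ^ 2
  have hI := Complex.I_sq
  have e1 : P.eval (Complex.I * m) = ((-(c₀ ^ 2 * m ^ 2) : ℝ) : ℂ) := by
    simp only [P, eval_add, eval_mul, eval_pow, eval_X, eval_C]
    push_cast
    linear_combination ((Complex.I * m) ^ 2 + b₀ * m ^ 2 * (Complex.I * m) + a * m ^ 2 + c₀ ^ 2)
      * m ^ 2 * hI
  have e2 : P.derivative.eval (Complex.I * m)
      = ((-(2 * b₀ * m ^ 4) : ℝ) : ℂ) + ((2 * m * ((a - 1) * m ^ 2 + c₀ ^ 2) : ℝ) : ℂ) * Complex.I := by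
    simp only [P, derivative_add, derivative_mul, derivative_pow, derivative_X, derivative_C,
      eval_add, eval_mul, eval_pow, eval_X, eval_C]
    simp
    linear_combination (2 * Complex.I * m + b₀ * m ^ 2) * m ^ 2 * hI
      + 2 * m * (b₀ * m ^ 3 + Complex.I * m ^ 2) * hI
  have hdeg : P.natDegree ≤ 4 := by
    simp only [P]
    compute_degree
  have n1 : ‖P.eval (Complex.I * m)‖ = c₀ ^ 2 * m ^ 2 := by
    rw [e1, Complex.norm_real, norm_neg, Real.norm_of_nonneg (by positivity)]
  -- The real part alone suffices, so no assumption relating a to 1 is needed.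
  have n2 : 2 * b₀ * m ^ 4 ≤ ‖P.derivative.eval (Complex.I * m)‖ := by
    have h := Complex.abs_re_le_norm (P.derivative.eval (Complex.I * m))
    rw [e2] at h ⊢
    simp only [Complex.add_re, Complex.ofReal_re, Complex.re_ofReal_mul, Complex.I_re, mul_zero,
      add_zero, abs_neg] at h
    rwa [abs_of_nonneg (by positivity)] at h
  have n0 : P.eval (Complex.I * m) ≠ 0 := by
    rw [← norm_pos_iff, n1]
    positivity
  -- Degree at most 4 against the factor 2 in the derivative bound: any constant above 2 in place of
  -- 3 gives the strict inequality.
  obtain ⟨l, hl, hd⟩ := exists_root_near (d := 3 * c₀ ^ 2 / (b₀ * m ^ 2)) n0 (by positivity) (by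
    rw [n1]
    calc (P.natDegree : ℝ) * (c₀ ^ 2 * m ^ 2) ≤ 4 * (c₀ ^ 2 * m ^ 2) := by
          gcongr
          exact_mod_cast hdeg
      _ < 6 * (c₀ ^ 2 * m ^ 2) := by
          have : 0 < c₀ ^ 2 * m ^ 2 := by positivity
          linarith
      _ = 3 * c₀ ^ 2 / (b₀ * m ^ 2) * (2 * b₀ * m ^ 4) := by
          field_simp
          ring
      _ ≤ _ := by gcongr)
  refine ⟨l, ?_, hd⟩
  simpa [P, Polynomial.IsRoot] using hl

theorem exists_eigenvector {L a b₀ c₀ m : ℝ} [Fact (0 < L)] [Fact (0 < a)] (hb : 0 < b₀)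
    (hc : 0 < c₀) (hm : 0 < m) (hs : Real.sin (m * L) = 0) :
    ∃ (l : ℂ) (U₀ : (waveOperator L a b₀ c₀).domain), waveOperator L a b₀ c₀ U₀ = l • (U₀ : _) ∧
      0 < ‖(U₀ : EnergySpace L a)‖ ∧ ‖Complex.I * m - l‖ ≤ 3 * c₀ ^ 2 / (b₀ * m ^ 2) := by
  have hL : 0 < L := Fact.out
  have ha : 0 < a := Fact.out
  obtain ⟨l, hl, hd⟩ := exists_eigenvalue a hb hc hm
  have hφ := sinMode_mem_H10 hL hs
  -- At l = 0 the characteristic polynomial equals am⁴ > 0. This is what makes the v-component of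
  -- the eigenvector nonzero below.
  have hl0 : l ≠ 0 := by
    rintro rfl
    have : (a : ℂ) * m ^ 2 * m ^ 2 = 0 := by simpa using hl
    have h' : a * m ^ 2 * m ^ 2 = 0 := by exact_mod_cast this
    exact absurd h' (by positivity)
  -- With p = -c₀l and q = l² + b₀m²l + am² the first mode equation is an identity, and the second
  -- becomes the characteristic equation.
  refine ⟨l, ⟨_, modeState_mem_waveDomain hL a b₀ hφ l (-(c₀ * l))
    (l ^ 2 + b₀ * m ^ 2 * l + a * m ^ 2)⟩, waveOperator_modeState hL a b₀ c₀ hφ (by ring) ?_, ?_, hd⟩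
  · linear_combination hl
  · rw [norm_pos_iff]
    intro h0
    have hv : (l * -(c₀ * l)) • sinMode L m = 0 := congrArg EnergySpace.v h0
    have hc' : (c₀ : ℂ) ≠ 0 := by exact_mod_cast hc.ne'
    rcases smul_eq_zero.1 hv with h | h
    · simp [hl0, hc'] at h
    · exact sinMode_ne_zero hL hm h

/-! ## Failure of decay rates faster than `1 / t` -/

/-- A uniform decay rate `t ^ (-r)` tested on the mode with wave number `m` at time `m²`. -/
theorem EnergyDecaysAtRate.bound {L a b₀ c₀ r C m : ℝ} [Fact (0 < L)] [Fact (0 < a)] (hb : 0 < b₀)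
    (hc : 0 < c₀) (hC : 0 < C) (hm : 1 ≤ m) (hs : Real.sin (m * L) = 0)
    (H : ∀ (U₀ : (waveOperator L a b₀ c₀).domain) (U : ℝ → EnergySpace L a),
      IsStrongSolution (waveOperator L a b₀ c₀) U₀ U → ∀ t : ℝ, 0 < t →
        energy (U t) ≤ C / t ^ r * domainNormSq (waveOperator L a b₀ c₀) U₀) :
    1 / 2 * Real.exp (-(3 * c₀ ^ 2 / b₀)) ^ 2
      ≤ C * (1 + (1 + 3 * c₀ ^ 2 / b₀) ^ 2) * (m ^ 2) ^ (-(r - 1)) := by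
  have hm0 : 0 < m := by linarith
  obtain ⟨l, U₀, hU, hpos, hd⟩ := exists_eigenvector (a := a) hb hc hm0 hs
  set K := 3 * c₀ ^ 2 / b₀ with hK
  have hK0 : 0 < K := by positivity
  have hd' : ‖Complex.I * m - l‖ ≤ K / m ^ 2 := by
    rwa [hK, div_div]
  -- The point im has real part 0, so Re l is at least minus the distance from l to im.
  have hre : -(K / m ^ 2) ≤ l.re := by
    have h := (Complex.abs_re_le_norm (Complex.I * m - l)).trans hd'
    have h' := (abs_le.1 h).2
    simp at h'
    linarith
  have hexp : -K ≤ l.re * m ^ 2 := by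
    have := mul_le_mul_of_nonneg_right hre (sq_nonneg m)
    have e : -(K / m ^ 2) * m ^ 2 = -K := by field_simp
    linarith
  have hln : ‖l‖ ≤ (1 + K) * m := by
    have h1 : ‖l‖ ≤ ‖Complex.I * m‖ + ‖Complex.I * m - l‖ := by
      have := norm_sub_le (Complex.I * m) (Complex.I * m - l)
      rwa [sub_sub_cancel] at this
    have h2 : ‖Complex.I * (m : ℂ)‖ = m := by
      rw [norm_mul, Complex.norm_I, one_mul, Complex.norm_real, Real.norm_of_nonneg hm0.le]
    have h3 : K / m ^ 2 ≤ K * m := by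
      calc K / m ^ 2 ≤ K := div_le_self hK0.le (one_le_pow₀ hm)
        _ ≤ K * m := le_mul_of_one_le_right hK0.le hm
    linarith
  have hmain := H U₀ _ (isStrongSolution_exp_smul _ U₀ l hU) (m ^ 2) (by positivity)
  rw [energy_eq_norm_sq, norm_smul, Complex.norm_exp, domainNormSq, hU, norm_smul] at hmain
  have hre2 : (l * ((m ^ 2 : ℝ) : ℂ)).re = l.re * m ^ 2 := by
    rw [mul_comm, Complex.re_ofReal_mul, mul_comm]
  rw [hre2] at hmain
  set w := ‖(U₀ : EnergySpace L a)‖ with hw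
  -- The numerator m² comes from the graph norm: it costs one power of t = m² and makes r = 1 the
  -- threshold.
  have hpow : (m ^ 2) / (m ^ 2) ^ r = (m ^ 2) ^ (-(r - 1)) := by
    rw [neg_sub, Real.rpow_sub (by positivity), Real.rpow_one]
  have hw2 : 0 < w ^ 2 := by positivity
  refine le_of_mul_le_mul_right ?_ hw2
  -- Since m ≥ 1, the summand 1 is absorbed into m².
  have hM : 1 + ‖l‖ ^ 2 ≤ (1 + (1 + K) ^ 2) * m ^ 2 := by
    have h1 : ‖l‖ ^ 2 ≤ ((1 + K) * m) ^ 2 := by gcongr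
    have h2 : 1 ≤ m ^ 2 := one_le_pow₀ hm
    nlinarith
  calc 1 / 2 * Real.exp (-K) ^ 2 * w ^ 2 ≤ 1 / 2 * Real.exp (l.re * m ^ 2) ^ 2 * w ^ 2 := by
        gcongr
    _ = 1 / 2 * (Real.exp (l.re * m ^ 2) * w) ^ 2 := by ring
    _ ≤ C / (m ^ 2) ^ r * (w ^ 2 + (‖l‖ * w) ^ 2) := hmain
    _ = C / (m ^ 2) ^ r * (1 + ‖l‖ ^ 2) * w ^ 2 := by ring
    _ ≤ C / (m ^ 2) ^ r * ((1 + (1 + K) ^ 2) * m ^ 2) * w ^ 2 := by gcongr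
    _ = C * (1 + (1 + K) ^ 2) * (m ^ 2) ^ (-(r - 1)) * w ^ 2 := by
        rw [← hpow]
        ring

theorem not_energyDecaysAtRate {L a b₀ c₀ r : ℝ} [hL : Fact (0 < L)] [Fact (0 < a)] (hb : 0 < b₀)
    (hc : 0 < c₀) (hr : 1 < r) : ¬ EnergyDecaysAtRate L a b₀ c₀ r := by
  rintro ⟨C, hC, H⟩
  have hL0 := hL.out
  -- The Dirichlet wave numbers, for which sin(mL) = 0. The value at n = 0 is excluded by passing to
  -- m ≥ 1, which holds eventually.
  let m : ℕ → ℝ := fun n => n * (Real.pi / L)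
  have hmt : Tendsto m atTop atTop :=
    tendsto_natCast_atTop_atTop.atTop_mul_const (by positivity)
  have hlim : Tendsto (fun n => C * (1 + (1 + 3 * c₀ ^ 2 / b₀) ^ 2) * (m n ^ 2) ^ (-(r - 1))) atTop
      (𝓝 (C * (1 + (1 + 3 * c₀ ^ 2 / b₀) ^ 2) * 0)) :=
    (((tendsto_rpow_neg_atTop (by linarith : 0 < r - 1)).comp
      ((tendsto_pow_atTop two_ne_zero).comp hmt))).const_mul _
  -- The left side of the bound is independent of n, so in the limit a positive number is at most 0.
  have hle := ge_of_tendsto hlim (b := 1 / 2 * Real.exp (-(3 * c₀ ^ 2 / b₀)) ^ 2) (by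
    filter_upwards [hmt.eventually_ge_atTop 1] with n hn
    refine EnergyDecaysAtRate.bound hb hc hC hn ?_ H
    have : m n * L = n * Real.pi := by
      simp only [m]
      field_simp
    rw [this, Real.sin_nat_mul_pi])
  have : 0 < Real.exp (-(3 * c₀ ^ 2 / b₀)) ^ 2 := by positivity
  linarith

end

end KelvinVoigt

theorem mainTheorem6 (L a b₀ c₀ : ℝ) [Fact (0 < L)] [Fact (0 < a)] (hb : 0 < b₀) (hc : 0 < c₀)
    (ε : ℝ) (hε : 0 < ε) (hε' : ε < 2) :
    ¬ KelvinVoigt.EnergyDecaysAtRate L a b₀ c₀ (2 / (2 - ε)) :=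
  KelvinVoigt.not_energyDecaysAtRate hb hc (by rw [lt_div_iff₀ (by linarith)]; linarith)
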